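/- Let $G$ be a finite connected multigraph (loops and parallel edges allowed) with a cellular embedding $G\to \mathit{KB}$ in the Klein bottle, that is, in the nonorientable closed surface with Euler characteristic $|V|-|E|+|F|=0$. The embedding is given combinatorially, by a rotation scheme (a cyclic order of the darts at every vertex) together with the set of orientation-reversing edges; the surface is obtained by thickening vertices to discs and edges to (possibly twisted) strips, and by gluing a disc, called a face, to each boundary component. Chains have coefficients in $\mathbb{Z}_2$. A 1-chain $z$ of $G$ induces a circle if its edges and their end vertices form a connected 2-regular subgraph $G\!:\!z$. The cycle space $Z(G)$ is spanned by all such chains, $B$ is the space of boundaries of 2-chains (sums of faces), and $H_1(\mathit{KB})=Z(G)/B$. An element of $Z(G)$ is homologically nontrivial if it is not in $B$. A circle is orientation-reversing if its ribbon neighborhood (the discs of its vertices together with the strips of its edges) is a Möbius band, and orientation-preserving otherwise. For $z_1,z_2\in Z(G)$, the $\mathbb{Z}_2$-intersection index $\langle z_1,z_2\rangle$ of their homology classes is the number mod 2 of points in which representatives in general position meet: one takes any cycle of $G$ homologous to $z_1$ and any 1-cycle of the dual graph $G^*$ homologous to $z_2$ (in the common barycentric subdivision), where each edge of $G$ crosses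 its own dual edge once and meets no other dual edge. Let $z_1,z_2\in Z(G)$. If $z_1$ induces an orientation-reversing circle and $z_2$ is homologically nontrivial and induces an orientation-preserving circle, then $\langle z_1,z_2\rangle$ is well defined and $\langle z_1,z_2\rangle=1$. -/

import Mathlib

/-- A multigraph (loops and parallel edges allowed) with vertex type `V` and edge type `E`.
Every edge `e` carries two darts (directed edges): the positive one `(e, true)` and the negative
one `(e, false)`; `tail` gives the vertex from which a dart starts. -/
structure DartGraph (V E : Type*) where
  /-- The vertex at which a dart starts. -/
  tail : E × Bool → V

namespace DartGraph

variable {V E : Type*}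

/-- The other dart on the same edge. -/
def opp (d : E × Bool) : E × Bool := (d.1, !d.2)

/-- The vertex at which a dart ends. -/
def head (G : DartGraph V E) (d : E × Bool) : V := G.tail (opp d)

/-- `u` and `v` are joined by a walk all of whose edges belong to `X`. -/
def Joined (G : DartGraph V E) (X : Set E) : V → V → Prop :=
  Relation.ReflTransGen fun u v => ∃ d : E × Bool, d.1 ∈ X ∧ G.tail d = u ∧ G.head d = v

/-- The graph is connected (and non-empty). -/
def Connected (G : DartGraph V E) : Prop :=
  Nonempty V ∧ ∀ u v : V, G.Joined Set.univ u v

/-- The set of edges that occur in a 1-chain with coefficients in `ℤ/2`. -/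
def edgeSet (z : E → ZMod 2) : Set E := {e | z e ≠ 0}

/-- The subgraph `G : z`, formed by the edges of the 1-chain `z` and their end vertices, is a
circle: it is non-empty, every vertex of it has degree 2 in it (a loop counts twice), and it is
connected. -/
def InducesCircle (G : DartGraph V E) (z : E → ZMod 2) : Prop :=
  (edgeSet z).Nonempty ∧
  (∀ d : E × Bool, d.1 ∈ edgeSet z →
    {d' : E × Bool | d'.1 ∈ edgeSet z ∧ G.tail d' = G.tail d}.ncard = 2) ∧
  (∀ d d' : E × Bool, d.1 ∈ edgeSet z → d'.1 ∈ edgeSet z →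
    G.Joined (edgeSet z) (G.tail d) (G.tail d'))

/-- The cycle space `Z(G)`: the span of the 1-chains that induce circles. -/
def cycleSpace (G : DartGraph V E) : Submodule (ZMod 2) (E → ZMod 2) :=
  Submodule.span (ZMod 2) {z | G.InducesCircle z}

end DartGraph

/-- A cellular embedding of a multigraph in a closed surface, given by its rotation scheme and by
its orientation-reversing edges. The surface is obtained by thickening every vertex to an
oriented disc, every edge to a strip glued to the discs at its ends (in the cyclic orders given by
`rot`; the strip is twisted exactly when `twisted` holds), and by gluing a disc (a face) to each
boundary component of the band surface that arises. -/
structure CellularEmbedding {V E : Type*} (G : DartGraph V E) where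
  /-- The dart that follows a given dart in the cyclic order around its tail. -/
  rot : Equiv.Perm (E × Bool)
  /-- The cycles of `rot` are exactly the sets of all darts that start at a vertex. -/
  sameCycle_rot_iff : ∀ d d' : E × Bool, rot.SameCycle d d' ↔ G.tail d = G.tail d'
  /-- Whether the edge is orientation-reversing. -/
  twisted : E → Bool

namespace CellularEmbedding

variable {V E : Type*} {G : DartGraph V E}

/-- The flags, that is, the triangles of the barycentric subdivision of the surface. The flag
`(d, s)` has as its corners the tail of `d`, the midpoint of the edge of `d` and the centre of a
face; it lies on the side of `d` towards the next dart `rot d` if `s = true`, and on the side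
towards the previous dart if `s = false`. -/
abbrev Flag (_ : CellularEmbedding G) : Type _ := (E × Bool) × Bool

/-- The flag next to a given one across the segment from the midpoint of the edge to the centre of
the face: same edge, same face, other end of the edge. In an untwisted strip, the side of `d`
towards `rot d` is the side of the opposite dart away from its own successor. -/
def acrossDual (S : CellularEmbedding G) (φ : S.Flag) : S.Flag :=
  (DartGraph.opp φ.1, if S.twisted φ.1.1 then φ.2 else !φ.2)

/-- The flag next to a given one across the segment from the vertex to the centre of the face:
same vertex, same corner of the face, other edge of that corner. -/
def acrossCorner (S : CellularEmbedding G) (φ : S.Flag) : S.Flag :=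
  if φ.2 then (S.rot φ.1, false) else (S.rot.symm φ.1, true)

/-- The flag next to a given one across the segment from the vertex to the midpoint of the edge:
same dart, other side. -/
def acrossEdge (S : CellularEmbedding G) (φ : S.Flag) : S.Flag := (φ.1, !φ.2)

/-- The faces: classes of flags under crossing segments that end at the centre of a face. -/
def Face (S : CellularEmbedding G) : Type _ :=
  Quot fun φ ψ : S.Flag => ψ = S.acrossDual φ ∨ ψ = S.acrossCorner φ

/-- The face in which a flag lies. -/
def face (S : CellularEmbedding G) (φ : S.Flag) : S.Face := Quot.mk _ φ

/-- The Euler characteristic `|V| - |E| + |F|` of the surface. -/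
noncomputable def eulerChar (S : CellularEmbedding G) : ℤ :=
  (Nat.card V : ℤ) - Nat.card E + Nat.card S.Face

/-- The band surface formed by the vertex discs and by the strips of the edges in `X` is
orientable: the discs can be oriented (`o v` tells whether the orientation of the disc at `v` is
reversed) so that the orientations agree along each of these strips. -/
def OrientableAlong (S : CellularEmbedding G) (X : Set E) : Prop :=
  ∃ o : V → Bool, ∀ e ∈ X,
    (S.twisted e = true ↔ o (G.tail (e, true)) ≠ o (G.tail (e, false)))

/-- The surface is orientable. -/
def Orientable (S : CellularEmbedding G) : Prop := S.OrientableAlong Set.univ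

/-- The surface is the Klein bottle: the nonorientable closed surface whose Euler characteristic
is that of the torus. -/
def IsKleinBottle (S : CellularEmbedding G) : Prop :=
  ¬ S.Orientable ∧ S.eulerChar = 0

/-- For a 1-chain `z` that induces a circle: its ribbon neighbourhood is a Möbius band (rather than
an annulus). -/
def OrientationReversing (S : CellularEmbedding G) (z : E → ZMod 2) : Prop :=
  ¬ S.OrientableAlong (DartGraph.edgeSet z)

/-- For a 1-chain `z` that induces a circle: its ribbon neighbourhood is not a Möbius band. -/
def OrientationPreserving (S : CellularEmbedding G) (z : E → ZMod 2) : Prop :=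
  ¬ S.OrientationReversing z

/-- The cellular boundary map from 2-chains to 1-chains over `ℤ/2`. The coefficient at an edge is
the sum of the coefficients of the faces on its two sides, so an edge occurs in the boundary of a
single face exactly when it occurs once in the boundary walk of that face. -/
def boundary (S : CellularEmbedding G) : (S.Face → ZMod 2) →ₗ[ZMod 2] (E → ZMod 2) where
  toFun c e := c (S.face ((e, true), true)) + c (S.face ((e, true), false))
  map_add' c c' := by
    funext e
    simp only [Pi.add_apply]
    ring
  map_smul' a c := by
    funext e
    simp only [Pi.smul_apply, smul_eq_mul, RingHom.id_apply]
    ring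

/-- Two 1-chains in `G` are homologous in the surface: they differ by a boundary. -/
def Homologous (S : CellularEmbedding G) (z z' : E → ZMod 2) : Prop :=
  z - z' ∈ LinearMap.range S.boundary

/-- The 1-chain `z` of `G` represents the zero class of `H₁ = Z(G) / B`. -/
def HomologicallyTrivial (S : CellularEmbedding G) (z : E → ZMod 2) : Prop :=
  S.Homologous z 0

/-- The 1-chain `z` in `G` is homologous to the 1-chain `y` in the dual graph (`y e` is the
coefficient of the dual edge that crosses `e` at its midpoint and joins the centres of the faces on
the two sides of `e`). Homologous means: in the barycentric subdivision there is a set `c` of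
triangles whose boundary mod 2 is `z + y`. Every segment of the subdivision borders exactly two
triangles. A segment from a vertex to the midpoint of an edge has coefficient `z e`, one from the
midpoint of an edge to the centre of a face has coefficient `y e`, and one from a vertex to the
centre of a face has coefficient `0`. -/
def HomologousToDual (S : CellularEmbedding G) (z y : E → ZMod 2) : Prop :=
  ∃ c : S.Flag → ZMod 2,
    (∀ φ, c φ + c (S.acrossEdge φ) = z φ.1.1) ∧
    (∀ φ, c φ + c (S.acrossDual φ) = y φ.1.1) ∧
    (∀ φ, c φ + c (S.acrossCorner φ) = 0)

/-- The number mod 2 of points in which a 1-chain `z` in `G` and a 1-chain `y` in the dual graph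
meet. The two are in general position: an edge meets no dual edge but its own, which it crosses
once. -/
def crossings [Fintype E] (z y : E → ZMod 2) : ZMod 2 := ∑ e, z e * y e

/-- The `ℤ/2`-intersection index of the homology classes of `z₁` and `z₂` is well defined and equal
to `n`: the class of `z₂` has representatives in the dual graph, and every such representative
meets every representative in `G` of the class of `z₁`, with which it is in general position, in a
number of points that is congruent to `n` mod 2. -/
def HasIntersectionIndex [Fintype E] (S : CellularEmbedding G) (z₁ z₂ : E → ZMod 2)
    (n : ZMod 2) : Prop :=
  (∃ y, S.HomologousToDual z₂ y) ∧
  ∀ x y, S.Homologous z₁ x → S.HomologousToDual z₂ y → crossings x y = n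

end CellularEmbedding

/-!
The proof is linear algebra over `ℤ/2`. Let `Z` be the kernel of the vertex boundary
`DartGraph.bdry`, let `B` be the space of boundaries of 2-chains, and let `w` be the 1-cochain that
is `1` on the twisted edges (a representative of the first Stiefel–Whitney class).

* `w` vanishes on `B` (`dotProduct_twist_boundary`), and a circle `z` is orientation-preserving
  exactly when `z ⬝ᵥ w = 0` (`dotProduct_twist_of_orientableAlong`,
  `orientableAlong_of_dotProduct_twist`).
* If `z` is homologous to the dual chain `y`, then `y` vanishes on `B`
  (`HomologousToDual.dotProduct_boundary`), and the self-intersection `z ⬝ᵥ y` equals `z ⬝ᵥ w`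
  (`HomologousToDual.dotProduct_self`, the Wu formula).
* The intersection form is nondegenerate: if `y` vanishes on all of `Z`, then `y` is a coboundary,
  that is, a boundary in the dual graph, and `z` lies in `B`
  (`HomologousToDual.homologicallyTrivial`).
* Euler characteristic `0` gives `dim Z ≤ dim B + 2` (`finrank_ker_bdry_le`).

Let `y` be a dual representative of `z₂`. Then `z₂ ⬝ᵥ y = z₂ ⬝ᵥ w = 0`. As `w` vanishes on `B` and on
`z₂` but not on `z₁`, and `z₂ ∉ B`, the space `B` and the chains `z₂`, `z₁` together span `Z`. So
`z₁ ⬝ᵥ y = 0` would make `y` vanish on `Z` and `z₂` trivial; hence `z₁ ⬝ᵥ y = 1`. Such a `y` exists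
by `exists_homologousToDual`, and replacing `z₁` by a homologous chain does not change `z₁ ⬝ᵥ y`, as
`y` vanishes on `B`.
-/

/-! ### Adjoint linear maps between function spaces -/

section Duality

open Module

variable {α β K : Type*} [Fintype α] [Fintype β] [Field K]

/-- The range of a linear map is the annihilator of the kernel of its adjoint. -/
theorem mem_range_of_adjoint (A : (α → K) →ₗ[K] (β → K)) (A' : (β → K) →ₗ[K] (α → K))
    (hA : ∀ f g, A f ⬝ᵥ g = f ⬝ᵥ A' g) (v : β → K) (hv : ∀ g, A' g = 0 → v ⬝ᵥ g = 0) :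
    v ∈ LinearMap.range A := by
  classical
  by_contra hmem
  obtain ⟨φ, hφv, hφ⟩ := Submodule.exists_le_ker_of_notMem hmem
  set g : β → K := fun i => φ (Pi.single i 1) with hg
  have key : ∀ u : β → K, φ u = u ⬝ᵥ g := by
    intro u
    conv_lhs => rw [pi_eq_sum_univ' u, map_sum]
    exact Finset.sum_congr rfl fun i _ => by
      rw [map_smul, smul_eq_mul, hg]
  have h0 : A' g = 0 := by
    refine dotProduct_eq_zero _ fun f => ?_
    rw [dotProduct_comm, ← hA, ← key]
    exact hφ ⟨f, rfl⟩
  exact hφv (by rw [key, hv g h0])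

theorem finrank_range_eq_of_adjoint (A : (α → K) →ₗ[K] (β → K)) (A' : (β → K) →ₗ[K] (α → K))
    (hA : ∀ f g, A f ⬝ᵥ g = f ⬝ᵥ A' g) :
    finrank K (LinearMap.range A') = finrank K (LinearMap.range A) := by
  classical
  have h : LinearMap.toMatrix' A' = (LinearMap.toMatrix' A).transpose := by
    ext i j
    have := hA (Pi.single i 1) (Pi.single j 1)
    rw [dotProduct_single_one, single_one_dotProduct] at this
    simp [LinearMap.toMatrix'_apply, Matrix.transpose_apply, this]
  have h1 := Matrix.rank_transpose (LinearMap.toMatrix' A)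
  rw [← h] at h1
  rw [Matrix.rank, Matrix.rank, ← Matrix.toLin'_apply', ← Matrix.toLin'_apply',
    Matrix.toLin'_toMatrix', Matrix.toLin'_toMatrix'] at h1
  exact h1

end Duality

/-! ### Boundary and coboundary of the graph -/

namespace DartGraph

variable {V E : Type*} (G : DartGraph V E)

/-- The coboundary of a 0-cochain. -/
def cobdry : (V → ZMod 2) →ₗ[ZMod 2] (E → ZMod 2) where
  toFun o e := o (G.tail (e, true)) + o (G.tail (e, false))
  map_add' o o' := by
    funext e
    simp only [Pi.add_apply]
    ring
  map_smul' a o := by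
    funext e
    simp only [Pi.smul_apply, smul_eq_mul, RingHom.id_apply]
    ring

open Classical in
/-- The boundary of a 1-chain: its coefficient at `v` is the sum over all darts that start at `v`,
so that a loop counts twice. -/
noncomputable def bdry [Fintype E] : (E → ZMod 2) →ₗ[ZMod 2] (V → ZMod 2) where
  toFun z v := ∑ d : E × Bool, if G.tail d = v then z d.1 else 0
  map_add' z z' := by
    funext v
    simp only [Pi.add_apply, ← Finset.sum_add_distrib]
    exact Finset.sum_congr rfl fun d _ => by split_ifs <;> simp
  map_smul' a z := by
    funext v
    simp only [Pi.smul_apply, smul_eq_mul, RingHom.id_apply, Finset.mul_sum]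
    exact Finset.sum_congr rfl fun d _ => by split_ifs <;> simp

theorem sum_darts {M : Type*} [AddCommMonoid M] [Fintype E] (f : E × Bool → M) :
    ∑ d, f d = ∑ e, (f (e, true) + f (e, false)) := by
  rw [Fintype.sum_prod_type]
  exact Finset.sum_congr rfl fun e _ => Fintype.sum_bool _

variable {G} in
theorem finrank_ker_cobdry_le (hG : G.Connected) :
    Module.finrank (ZMod 2) (LinearMap.ker G.cobdry) ≤ 1 := by
  obtain ⟨⟨v₀⟩, hconn⟩ := hG
  have h1 : (1 : V → ZMod 2) ∈ LinearMap.ker G.cobdry :=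
    funext fun _ => CharTwo.add_self_eq_zero _
  refine finrank_le_one ⟨1, h1⟩ fun o => ⟨o.1 v₀, Subtype.ext (funext fun v => ?_)⟩
  suffices o.1 v₀ = o.1 v by simpa using this
  have hv := hconn v₀ v
  induction hv with
  | refl => rfl
  | tail _ hstep ih =>
    obtain ⟨⟨e, b⟩, -, rfl, rfl⟩ := hstep
    have h := CharTwo.add_eq_zero.mp (congrFun o.2 e)
    cases b
    · exact ih.trans h.symm
    · exact ih.trans h

variable [Fintype E]

theorem dotProduct_bdry [Fintype V] (o : V → ZMod 2) (z : E → ZMod 2) :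
    o ⬝ᵥ G.bdry z = ∑ d : E × Bool, o (G.tail d) * z d.1 := by
  classical
  simp only [dotProduct, bdry, LinearMap.coe_mk, AddHom.coe_mk, Finset.mul_sum]
  rw [Finset.sum_comm]
  exact Finset.sum_congr rfl fun d _ => by simp

theorem cobdry_dotProduct [Fintype V] (o : V → ZMod 2) (z : E → ZMod 2) :
    G.cobdry o ⬝ᵥ z = o ⬝ᵥ G.bdry z := by
  rw [dotProduct_bdry, sum_darts]
  exact Finset.sum_congr rfl fun e _ => by simp [cobdry, add_mul]

theorem zmod_two_eq_zero_or_one (a : ZMod 2) : a = 0 ∨ a = 1 := by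
  revert a
  decide

theorem InducesCircle.bdry_eq_zero {G : DartGraph V E} {z : E → ZMod 2} (hz : G.InducesCircle z) :
    G.bdry z = 0 := by
  classical
  funext v
  simp only [bdry, LinearMap.coe_mk, AddHom.coe_mk, Pi.zero_apply]
  by_cases h : ∃ d : E × Bool, d.1 ∈ edgeSet z ∧ G.tail d = v
  · obtain ⟨d, hd, rfl⟩ := h
    have hcard := hz.2.1 d hd
    have hset : {d' : E × Bool | d'.1 ∈ edgeSet z ∧ G.tail d' = G.tail d} =
        (Finset.univ.filter fun d' : E × Bool => d'.1 ∈ edgeSet z ∧ G.tail d' = G.tail d :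
          Finset (E × Bool)) := by
      ext
      simp
    rw [hset, Set.ncard_coe_finset] at hcard
    have : ∀ d' : E × Bool, (if G.tail d' = G.tail d then z d'.1 else 0) =
        if d'.1 ∈ edgeSet z ∧ G.tail d' = G.tail d then 1 else 0 := by
      intro d'
      rcases zmod_two_eq_zero_or_one (z d'.1) with h | h <;> simp [edgeSet, h]
    rw [Finset.sum_congr rfl fun d' _ => this d', Finset.sum_boole, hcard]
    decide
  · refine Finset.sum_eq_zero fun d _ => ?_
    split_ifs with hd
    · by_contra hne
      exact h ⟨d, hne, hd⟩
    · rfl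

/-- The only cycles supported on a circle are zero and the circle itself. -/
theorem InducesCircle.eq_of_bdry_mul_eq_zero {G : DartGraph V E} {z u : E → ZMod 2}
    (hz : G.InducesCircle z) (hu : G.bdry (z * u) = 0) {e e' : E}
    (he : e ∈ edgeSet z) (he' : e' ∈ edgeSet z) : u e = u e' := by
  classical
  have hone : ∀ {e}, e ∈ edgeSet z → z e = 1 := fun {e} h =>
    (zmod_two_eq_zero_or_one (z e)).resolve_left h
  -- The two darts of the circle at a vertex carry the same coefficient.
  have hloc : ∀ a b : E × Bool, a.1 ∈ edgeSet z → b.1 ∈ edgeSet z → G.tail a = G.tail b →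
      u a.1 = u b.1 := by
    intro a b ha hb hab
    by_cases hne : a = b
    · rw [hne]
    have hset : ({a, b} : Set (E × Bool)) =
        {d' : E × Bool | d'.1 ∈ edgeSet z ∧ G.tail d' = G.tail b} := by
      refine Set.eq_of_subset_of_ncard_le ?_ ?_ (Set.toFinite _)
      · rintro d (rfl | rfl)
        · exact ⟨ha, hab⟩
        · exact ⟨hb, rfl⟩
      · rw [hz.2.1 b hb, Set.ncard_pair hne]
    have h0 := congrFun hu (G.tail b)
    simp only [bdry, LinearMap.coe_mk, AddHom.coe_mk, Pi.zero_apply, Pi.mul_apply] at h0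
    rw [← Finset.sum_subset (Finset.subset_univ {a, b}), Finset.sum_pair hne] at h0
    · rw [if_pos hab, if_pos rfl, hone ha, hone hb, one_mul, one_mul] at h0
      exact CharTwo.add_eq_zero.mp h0
    · intro d _ hd
      split_ifs with ht
      · by_cases hm : d.1 ∈ edgeSet z
        · have : d ∈ ({a, b} : Set (E × Bool)) := by
            rw [hset]
            exact ⟨hm, ht⟩
          exact absurd (by simpa using this) hd
        · rw [not_not.mp hm, zero_mul]
      · rfl
  have hwalk : ∀ v, G.Joined (edgeSet z) (G.tail (e, true)) v →
      ∀ d : E × Bool, d.1 ∈ edgeSet z → G.tail d = v → u e = u d.1 := by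
    intro v hv
    induction hv with
    | refl => exact fun d hd h => hloc (e, true) d he hd h.symm
    | tail _ hstep ih =>
      obtain ⟨a, ha, ha1, ha2⟩ := hstep
      intro d hd h
      rw [ih a ha ha1]
      exact hloc (opp a) d ha hd (ha2.trans h.symm)
  exact hwalk _ (hz.2.2 (e, true) (e', true) he he') (e', true) he' rfl

end DartGraph

namespace CellularEmbedding

variable {V E : Type*} {G : DartGraph V E} (S : CellularEmbedding G)

open DartGraph Module

/-! ### Boundaries in the graph and in the dual graph -/

variable {S}

variable (S) in
theorem tail_acrossCorner (φ : S.Flag) : G.tail (S.acrossCorner φ).1 = G.tail φ.1 := by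
  refine (S.sameCycle_rot_iff _ _).mp ?_
  unfold acrossCorner
  split_ifs
  · exact Equiv.Perm.sameCycle_apply_left.mpr (Equiv.Perm.SameCycle.refl _ _)
  · exact Equiv.Perm.sameCycle_symm_apply_left.mpr (Equiv.Perm.SameCycle.refl _ _)

variable (S) in
/-- Coboundaries in the graph are boundaries in the dual graph: the faces of the dual graph are the
stars of the vertices. -/
theorem homologousToDual_zero_cobdry (o : V → ZMod 2) : S.HomologousToDual 0 (G.cobdry o) := by
  refine ⟨fun φ => o (G.tail φ.1), fun φ => CharTwo.add_self_eq_zero _, ?_, fun φ => ?_⟩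
  · rintro ⟨⟨e, b⟩, s⟩
    cases b
    · exact add_comm _ _
    · rfl
  · beta_reduce
    rw [tail_acrossCorner, CharTwo.add_self_eq_zero]

theorem homologicallyTrivial_of_homologousToDual_zero {z : E → ZMod 2}
    (h : S.HomologousToDual z 0) : S.HomologicallyTrivial z := by
  obtain ⟨c, he, hd, hc⟩ := h
  refine ⟨Quot.lift c ?_, ?_⟩
  · rintro φ ψ (rfl | rfl)
    · exact CharTwo.add_eq_zero.mp (hd φ)
    · exact CharTwo.add_eq_zero.mp (hc φ)
  · rw [sub_zero]
    exact funext fun e => he ((e, true), true)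

theorem HomologousToDual.add {z z' y y' : E → ZMod 2} (h : S.HomologousToDual z y)
    (h' : S.HomologousToDual z' y') : S.HomologousToDual (z + z') (y + y') := by
  obtain ⟨c, he, hd, hc⟩ := h
  obtain ⟨c', he', hd', hc'⟩ := h'
  refine ⟨c + c', fun φ => ?_, fun φ => ?_, fun φ => ?_⟩ <;>
    simp only [Pi.add_apply] <;> rw [add_add_add_comm]
  · rw [he, he']
  · rw [hd, hd']
  · rw [hc, hc', add_zero]

variable (S)

/-! ### The orientation character -/

/-- The 1-cochain that is `1` exactly on the orientation-reversing edges. -/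
def twist (e : E) : ZMod 2 := if S.twisted e then 1 else 0

theorem face_acrossDual (φ : S.Flag) : S.face (S.acrossDual φ) = S.face φ :=
  Eq.symm <| Quot.sound <| Or.inl rfl

theorem face_rot (d : E × Bool) : S.face (S.rot d, false) = S.face (d, true) :=
  Eq.symm <| Quot.sound <| Or.inr <| by simp [acrossCorner]

/-- A function of darts that is invariant under the rotation depends only on the tail. -/
theorem eq_of_tail_eq [Finite E] {M : Type*} {u : E × Bool → M} (hu : ∀ d, u (S.rot d) = u d)
    {d d' : E × Bool} (h : G.tail d = G.tail d') : u d = u d' := by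
  obtain ⟨n, rfl⟩ := ((S.sameCycle_rot_iff d d').mpr h).exists_nat_pow_eq
  clear h
  induction n with
  | zero => rfl
  | succ n ih => rw [pow_succ', Equiv.Perm.mul_apply, hu, ← ih]

variable [Fintype E]

theorem dotProduct_twist_of_orientableAlong [Fintype V] {z : E → ZMod 2} (hz : G.bdry z = 0)
    (ho : S.OrientableAlong (edgeSet z)) : z ⬝ᵥ S.twist = 0 := by
  obtain ⟨o, ho⟩ := ho
  have h := G.cobdry_dotProduct (fun v => if o v then 1 else 0) z
  rw [hz, dotProduct_zero] at h
  rw [← h, dotProduct_comm]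
  refine Finset.sum_congr rfl fun e _ => ?_
  by_cases he : e ∈ edgeSet z
  · have := ho e he
    congr 1
    simp only [twist, cobdry, LinearMap.coe_mk, AddHom.coe_mk]
    rcases h1 : S.twisted e <;> rcases h2 : o (G.tail (e, true)) <;>
      rcases h3 : o (G.tail (e, false)) <;> simp [h1, h2, h3] at this ⊢
    decide
  · rw [not_not.mp he, mul_zero, mul_zero]

/-- By duality the restriction of the orientation character to a circle is a coboundary if it
vanishes on all cycles supported there, and the circle itself is the only nonzero one. -/
theorem orientableAlong_of_dotProduct_twist [Fintype V] {z : E → ZMod 2} (hz : G.InducesCircle z)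
    (h0 : z ⬝ᵥ S.twist = 0) : S.OrientableAlong (edgeSet z) := by
  have hmem : z * S.twist ∈ LinearMap.range (LinearMap.mulLeft (ZMod 2) z ∘ₗ G.cobdry) := by
    refine mem_range_of_adjoint _ (G.bdry ∘ₗ LinearMap.mulLeft (ZMod 2) z) ?_ _ ?_
    · intro o u
      rw [LinearMap.comp_apply, LinearMap.comp_apply, ← cobdry_dotProduct]
      exact Finset.sum_congr rfl fun e _ => by
        simp only [LinearMap.mulLeft_apply, Pi.mul_apply]
        ring
    · intro u hu
      obtain ⟨e₀, he₀⟩ := hz.1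
      have : (z * S.twist) ⬝ᵥ u = u e₀ * (z ⬝ᵥ S.twist) := by
        simp only [dotProduct, Finset.mul_sum, Pi.mul_apply]
        refine Finset.sum_congr rfl fun e _ => ?_
        by_cases he : e ∈ edgeSet z
        · rw [hz.eq_of_bdry_mul_eq_zero hu he₀ he]
          ring
        · rw [not_not.mp he]
          ring
      rw [this, h0, mul_zero]
  obtain ⟨o, ho⟩ := hmem
  refine ⟨fun v => decide (o v = 1), fun e he => ?_⟩
  have h := congrFun ho e
  simp only [LinearMap.comp_apply, LinearMap.mulLeft_apply, Pi.mul_apply] at h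
  replace h := mul_left_cancel₀ he h
  simp only [twist, cobdry, LinearMap.coe_mk, AddHom.coe_mk] at h
  beta_reduce
  revert h
  generalize o (G.tail (e, true)) = a
  generalize o (G.tail (e, false)) = b
  generalize S.twisted e = t
  revert a b t
  decide

/-- The orientation character vanishes on boundaries of 2-chains. Along the boundary walk of a face
the side of the dart is switched at every corner and at every untwisted edge, so the number of
twisted edges on it is even. -/
theorem dotProduct_twist_boundary (p : S.Face → ZMod 2) : S.boundary p ⬝ᵥ S.twist = 0 := by
  -- The count is done with integer lifts, as it divides by two.
  set q : S.Flag → ℤ := fun φ => ((p (S.face φ)).val : ℤ) with hq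
  have hrot : ∑ d : E × Bool, q (d, true) = ∑ d : E × Bool, q (d, false) := by
    rw [← Equiv.sum_comp S.rot fun d => q (d, false)]
    exact Finset.sum_congr rfl fun d _ => by simp only [hq, face_rot]
  rw [sum_darts, sum_darts] at hrot
  have hdual : ∀ e s, q ((e, false), s) = q ((e, true), if S.twisted e then s else !s) := by
    intro e s
    have := S.face_acrossDual ((e, false), s)
    simp only [acrossDual, opp] at this
    simp only [hq, ← this]
    rfl
  have hsum : ∑ e, (if S.twisted e then q ((e, true), true) - q ((e, true), false) else 0) = 0 := by
    have h2 : ∑ e, 2 * (if S.twisted e then q ((e, true), true) - q ((e, true), false) else 0)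
        = 0 := by
      refine Eq.trans ?_ (sub_eq_zero.mpr hrot)
      rw [← Finset.sum_sub_distrib]
      refine Finset.sum_congr rfl fun e _ => ?_
      rw [hdual e true, hdual e false]
      cases S.twisted e <;> simp <;> ring
    rw [← Finset.mul_sum] at h2
    simpa using h2
  have hcast := congrArg (Int.cast : ℤ → ZMod 2) hsum
  rw [Int.cast_sum, Int.cast_zero] at hcast
  rw [← hcast]
  refine Finset.sum_congr rfl fun e _ => ?_
  simp only [boundary, LinearMap.coe_mk, AddHom.coe_mk, twist, hq]
  cases S.twisted e <;> simp [CharTwo.sub_eq_add]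

/-! ### Representatives in the dual graph -/

variable {S}

/-- A dual representative meets every boundary evenly: summing `p (S.face φ) * c φ` over all flags
`φ` gives `0`, because the terms of two flags that share a corner of a face agree. -/
theorem HomologousToDual.dotProduct_boundary {z y : E → ZMod 2} (h : S.HomologousToDual z y)
    (p : S.Face → ZMod 2) : S.boundary p ⬝ᵥ y = 0 := by
  obtain ⟨c, -, hd, hc⟩ := h
  set q : S.Flag → ZMod 2 := fun φ => p (S.face φ) * c φ with hq
  have hrot : ∑ d : E × Bool, q (d, true) = ∑ d : E × Bool, q (d, false) := by
    rw [← Equiv.sum_comp S.rot fun d => q (d, false)]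
    refine Finset.sum_congr rfl fun d _ => ?_
    have := hc (d, true)
    simp only [acrossCorner, if_true] at this
    simp only [hq, face_rot, CharTwo.add_eq_zero.mp this]
  rw [← CharTwo.add_eq_zero, ← Finset.sum_add_distrib, sum_darts] at hrot
  rw [← hrot]
  refine Finset.sum_congr rfl fun e _ => ?_
  have h1 := hd ((e, true), true)
  have h2 := hd ((e, true), false)
  have f1 := S.face_acrossDual ((e, true), true)
  have f2 := S.face_acrossDual ((e, true), false)
  simp only [boundary, LinearMap.coe_mk, AddHom.coe_mk, hq, add_mul]
  simp only [acrossDual, opp] at h1 h2 f1 f2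
  nth_rewrite 1 [← h1]
  rw [← h2]
  revert f1 f2
  cases S.twisted e <;> intro f1 f2 <;> simp at f1 f2 ⊢ <;> rw [f1, f2] <;> ring

/-- The Wu formula: the self-intersection index of a cycle is its orientation character. -/
theorem HomologousToDual.dotProduct_self {z y : E → ZMod 2} (h : S.HomologousToDual z y) :
    z ⬝ᵥ y = z ⬝ᵥ S.twist := by
  obtain ⟨c, he, hd, hc⟩ := h
  have hrot : ∀ d, c (S.rot d, false) = c (d, true) := fun d => by
    have := hc (d, true)
    simp only [acrossCorner, if_true] at this
    exact (CharTwo.add_eq_zero.mp this).symm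
  have hedge : ∀ d : E × Bool, c (d, false) = c (d, true) + z d.1 := fun d => by
    rw [← he (d, true)]
    simp only [acrossEdge, Bool.not_true]
    rw [← add_assoc, CharTwo.add_self_eq_zero, zero_add]
  -- In the rotation at a vertex, `c` jumps up as often as it jumps down, and it jumps exactly at
  -- the darts of `z`; so the number of upward jumps is the number of edges of `z`.
  have hjump : ∑ d : E × Bool, z d.1 * c (d, true) = ∑ e, z e := by
    have h0 : ∑ d : E × Bool, (((c (d, true)).val : ℤ) - (c (d, false)).val) = 0 := by
      rw [Finset.sum_sub_distrib, sub_eq_zero,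
        ← Equiv.sum_comp S.rot fun d => ((c (d, false)).val : ℤ)]
      exact Finset.sum_congr rfl fun d _ => by rw [hrot]
    have h1 : ∑ d : E × Bool, (2 * ((z d.1 * c (d, true)).val : ℤ) - (z d.1).val) = 0 := by
      rw [← h0]
      refine Finset.sum_congr rfl fun d _ => ?_
      rw [hedge]
      generalize c (d, true) = a
      generalize z d.1 = b
      revert a b
      decide
    rw [Finset.sum_sub_distrib, sub_eq_zero, ← Finset.mul_sum,
      sum_darts fun d => ((z d.1).val : ℤ)] at h1
    simp only [← two_mul] at h1
    rw [← Finset.mul_sum] at h1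
    have h2 := congrArg (Int.cast : ℤ → ZMod 2) (mul_left_cancel₀ two_ne_zero h1)
    simpa using h2
  have hpt : ∀ e, z e * y e =
      (z e * c ((e, true), true) + z e * c ((e, false), true)) + z e + z e * S.twist e := by
    intro e
    have h1 := hd ((e, true), true)
    have h2 := hedge (e, false)
    simp only [acrossDual, opp, Bool.not_true] at h1 h2
    simp only [twist]
    rw [← h1]
    rw [apply_ite fun s => c ((e, false), s)]
    revert h2
    generalize c ((e, false), false) = a
    generalize c ((e, false), true) = a'
    generalize c ((e, true), true) = b
    generalize z e = k
    generalize S.twisted e = t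
    revert a a' b k t
    decide
  have hsum : z ⬝ᵥ y = (∑ e, (z e * c ((e, true), true) + z e * c ((e, false), true))) +
      ∑ e, z e + z ⬝ᵥ S.twist := by
    simp only [dotProduct]
    rw [← Finset.sum_add_distrib, ← Finset.sum_add_distrib]
    exact Finset.sum_congr rfl fun e _ => hpt e
  rw [sum_darts] at hjump
  rw [hsum, hjump, CharTwo.add_self_eq_zero, zero_add]

/-- Nondegeneracy of the intersection form: a cycle with a dual representative that meets every
cycle evenly is a boundary. -/
theorem HomologousToDual.homologicallyTrivial [Fintype V] {z y : E → ZMod 2}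
    (h : S.HomologousToDual z y) (hy : ∀ x, G.bdry x = 0 → y ⬝ᵥ x = 0) :
    S.HomologicallyTrivial z := by
  obtain ⟨o, rfl⟩ := mem_range_of_adjoint _ _ G.cobdry_dotProduct y hy
  have h0 := h.add (S.homologousToDual_zero_cobdry o)
  have hself : G.cobdry o + G.cobdry o = 0 := funext fun _ => CharTwo.add_self_eq_zero _
  rw [hself, add_zero] at h0
  exact homologicallyTrivial_of_homologousToDual_zero h0

variable (S)

/-- Every cycle is homologous to a chain in the dual graph: as the cycle has an even number of darts
at each vertex, the triangles around that vertex can be 2-coloured so that the colour changes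
exactly across the darts of the cycle. -/
theorem exists_homologousToDual [Fintype V] {z : E → ZMod 2} (hz : G.bdry z = 0) :
    ∃ y, S.HomologousToDual z y := by
  have hmem : (fun d => z (S.rot d).1) ∈ LinearMap.range
      (LinearMap.funLeft (ZMod 2) (ZMod 2) S.rot + LinearMap.id) := by
    refine mem_range_of_adjoint _
      (LinearMap.funLeft (ZMod 2) (ZMod 2) S.rot.symm + LinearMap.id) ?_ _ ?_
    · intro f g
      simp only [LinearMap.add_apply, LinearMap.id_apply, add_dotProduct, dotProduct_add]
      congr 1
      simp only [dotProduct, LinearMap.funLeft_apply]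
      rw [← Equiv.sum_comp S.rot fun d => f d * g (S.rot.symm d)]
      simp
    · intro u hu
      have hinv : ∀ d, u (S.rot d) = u d := by
        intro d
        have := congrFun hu (S.rot d)
        simp only [LinearMap.add_apply, LinearMap.id_apply, Pi.add_apply, LinearMap.funLeft_apply,
          Equiv.symm_apply_apply, Pi.zero_apply] at this
        exact (CharTwo.add_eq_zero.mp this).symm
      have htail : ∃ o : V → ZMod 2, ∀ d, u d = o (G.tail d) := by
        exact ⟨Function.extend G.tail u 0, fun d =>
          (Function.FactorsThrough.extend_apply (g := u)
            (fun _ _ h => S.eq_of_tail_eq hinv h) 0 d).symm⟩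
      obtain ⟨o, ho⟩ := htail
      have h0 := G.dotProduct_bdry o z
      rw [hz, dotProduct_zero, ← Equiv.sum_comp S.rot] at h0
      rw [h0]
      exact Finset.sum_congr rfl fun d _ => by rw [← ho, hinv, mul_comm]
  obtain ⟨g, hg⟩ := hmem
  have hg' : ∀ d, g (S.rot d) + z (S.rot d).1 = g d := by
    intro d
    have := congrFun hg d
    simp only [LinearMap.add_apply, LinearMap.id_apply, Pi.add_apply, LinearMap.funLeft_apply]
      at this
    rw [← this, ← add_assoc, CharTwo.add_self_eq_zero, zero_add]
  set c : S.Flag → ZMod 2 := fun φ => if φ.2 then g φ.1 else g φ.1 + z φ.1.1 with hcdef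
  have hE : ∀ φ, c φ + c (S.acrossEdge φ) = z φ.1.1 := by
    rintro ⟨d, s⟩
    simp only [hcdef, acrossEdge]
    generalize g d = a
    generalize z d.1 = b
    revert a b s
    decide
  have hC : ∀ φ, c φ + c (S.acrossCorner φ) = 0 := by
    rintro ⟨d, s⟩
    rw [CharTwo.add_eq_zero]
    cases s
    · have := hg' (S.rot.symm d)
      rw [Equiv.apply_symm_apply] at this
      simpa [hcdef, acrossCorner] using this
    · simpa [hcdef, acrossCorner] using (hg' d).symm
  refine ⟨fun e => c ((e, true), true) + c (S.acrossDual ((e, true), true)), c, hE, ?_, hC⟩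
  rintro ⟨⟨e, b⟩, s⟩
  have h1 := hE ((e, true), true)
  have h2 := hE ((e, false), true)
  simp only [acrossEdge, acrossDual, opp, Bool.not_true] at h1 h2 ⊢
  have hfour : ∀ k a b a' b' : ZMod 2, a + b = k → a' + b' = k →
      a' + a = a + a' ∧ b' + b = a + a' ∧ a + a' = b + b' ∧ a' + b = a + b' ∧ b' + a = a + b' ∧
        b + a' = a + b' := by
    decide
  have := hfour _ _ _ _ _ h1 h2
  rcases b <;> rcases s <;> rcases S.twisted e <;> simp <;> grind

/-! ### The dimension of the first homology -/

/-- A boundary of faces is a cycle: it is orthogonal to every coboundary `G.cobdry o`, since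
`G.cobdry o` is a dual representative of `0`. -/
theorem bdry_boundary [Fintype V] (p : S.Face → ZMod 2) : G.bdry (S.boundary p) = 0 :=
  dotProduct_eq_zero _ fun o => by
    rw [dotProduct_comm, ← cobdry_dotProduct, dotProduct_comm]
    exact (S.homologousToDual_zero_cobdry o).dotProduct_boundary p

/-- The surface is connected: a function on faces without jumps across edges is constant. -/
theorem eq_of_boundary_eq_zero (hG : G.Connected) {p : S.Face → ZMod 2} (hp : S.boundary p = 0)
    (f f' : S.Face) : p f = p f' := by
  set q : E × Bool → ZMod 2 := fun d => p (S.face (d, true)) with hq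
  have hedge : ∀ e, p (S.face ((e, true), true)) = p (S.face ((e, true), false)) := fun e =>
    CharTwo.add_eq_zero.mp (congrFun hp e)
  have hflag : ∀ d s, p (S.face (d, s)) = q (d.1, true) := by
    rintro ⟨e, b⟩ s
    cases b
    · rw [← face_acrossDual]
      simp only [acrossDual, opp, Bool.not_false]
      generalize (if S.twisted e = true then s else !s) = t
      cases t
      · exact (hedge e).symm
      · rfl
    · cases s
      · exact (hedge e).symm
      · rfl
  have hrot : ∀ d, q (S.rot d) = q d := fun d => by
    change p (S.face (S.rot d, true)) = p (S.face (d, true))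
    rw [← S.face_rot d, hflag (S.rot d) false, hflag (S.rot d) true]
  have htail : ∀ d d', G.tail d = G.tail d' → q d = q d' := fun d d' h =>
    S.eq_of_tail_eq hrot h
  have hwalk : ∀ d v, G.Joined Set.univ (G.tail d) v → ∀ d', G.tail d' = v → q d = q d' := by
    intro d v hv
    induction hv with
    | refl => exact fun d' h => htail d d' h.symm
    | tail _ hstep ih =>
      obtain ⟨a, -, ha, ha'⟩ := hstep
      intro d' h
      rw [ih a ha, ← htail (opp a) d' (ha'.trans h.symm)]
      exact (hflag a true).trans (hflag (opp a) true).symm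
  induction f using Quot.ind with | _ φ
  induction f' using Quot.ind with | _ ψ
  change p (S.face (φ.1, φ.2)) = p (S.face (ψ.1, ψ.2))
  rw [hflag, hflag]
  exact hwalk _ _ (hG.2 _ _) _ rfl

theorem finrank_ker_boundary_le (hG : G.Connected) :
    finrank (ZMod 2) (LinearMap.ker S.boundary) ≤ 1 := by
  have h1 : (1 : S.Face → ZMod 2) ∈ LinearMap.ker S.boundary :=
    funext fun _ => CharTwo.add_self_eq_zero _
  refine finrank_le_one ⟨1, h1⟩ fun p => ?_
  rcases isEmpty_or_nonempty S.Face with _ | ⟨⟨f⟩⟩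
  · exact ⟨0, Subtype.ext (Subsingleton.elim _ _)⟩
  · refine ⟨p.1 f, Subtype.ext (funext fun f' => ?_)⟩
    simpa using S.eq_of_boundary_eq_zero hG p.2 f f'

/-- If `|V| - |E| + |F| = 0`, then the first homology has dimension at most 2: connectedness bounds
the kernels of `G.cobdry` and of `S.boundary`, and `G.bdry` has the rank of its adjoint `G.cobdry`. -/
theorem finrank_ker_bdry_le [Fintype V] (hG : G.Connected) (hχ : S.eulerChar = 0) :
    finrank (ZMod 2) (LinearMap.ker G.bdry) ≤
      finrank (ZMod 2) (LinearMap.range S.boundary) + 2 := by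
  classical
  have : Finite S.Face := Quot.finite _
  have := Fintype.ofFinite S.Face
  have hF := S.boundary.finrank_range_add_finrank_ker
  have hZ := G.bdry.finrank_range_add_finrank_ker
  have hV := G.cobdry.finrank_range_add_finrank_ker
  rw [finrank_fintype_fun_eq_card] at hF hZ hV
  have hrank := finrank_range_eq_of_adjoint _ _ G.cobdry_dotProduct
  have h1 := S.finrank_ker_boundary_le hG
  have h2 := finrank_ker_cobdry_le hG
  rw [eulerChar, Nat.card_eq_fintype_card, Nat.card_eq_fintype_card,
    Nat.card_eq_fintype_card] at hχ
  omega

end CellularEmbedding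

/-! ### The intersection index -/

open CellularEmbedding DartGraph Module in
theorem lemma2p5 {V E : Type*} [Fintype V] [Fintype E] (G : DartGraph V E) (hG : G.Connected)
    (S : CellularEmbedding G) (hS : S.IsKleinBottle)
    (z₁ z₂ : E → ZMod 2) (hz₁ : z₁ ∈ G.cycleSpace) (hz₂ : z₂ ∈ G.cycleSpace)
    (hc₁ : G.InducesCircle z₁) (hr₁ : S.OrientationReversing z₁)
    (hc₂ : G.InducesCircle z₂) (hp₂ : S.OrientationPreserving z₂)
    (hn₂ : ¬ S.HomologicallyTrivial z₂) :
    S.HasIntersectionIndex z₁ z₂ 1 := by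
  have hw₁ : z₁ ⬝ᵥ S.twist ≠ 0 := fun h => hr₁ (S.orientableAlong_of_dotProduct_twist hc₁ h)
  have hw₂ : z₂ ⬝ᵥ S.twist = 0 :=
    S.dotProduct_twist_of_orientableAlong hc₂.bdry_eq_zero (not_not.mp hp₂)
  refine ⟨S.exists_homologousToDual hc₂.bdry_eq_zero, ?_⟩
  rintro x y ⟨p, hp⟩ hy
  have hx : crossings x y = z₁ ⬝ᵥ y := by
    have h := hy.dotProduct_boundary p
    rw [hp, sub_dotProduct, sub_eq_zero] at h
    exact h.symm
  rw [hx]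
  refine (zmod_two_eq_zero_or_one _).resolve_left fun h₁ => hn₂ ?_
  have h₂ : z₂ ⬝ᵥ y = 0 := hy.dotProduct_self.trans hw₂
  set B := LinearMap.range S.boundary with hB
  set W := B ⊔ Submodule.span (ZMod 2) {z₂}
  set W' := W ⊔ Submodule.span (ZMod 2) {z₁}
  have hz₂B : z₂ ∉ B := fun h => hn₂ (by rwa [HomologicallyTrivial, Homologous, sub_zero])
  have hz₁W : z₁ ∉ W := by
    have hle : W ≤ LinearMap.ker (Fintype.linearCombination (ZMod 2) S.twist) := by
      refine sup_le ?_ ((Submodule.span_singleton_le_iff_mem _ _).mpr hw₂)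
      rintro _ ⟨q, rfl⟩
      exact S.dotProduct_twist_boundary q
    exact fun h => hw₁ (hle h)
  have hle : W' ≤ LinearMap.ker (Fintype.linearCombination (ZMod 2) y) := by
    refine sup_le (sup_le ?_ ((Submodule.span_singleton_le_iff_mem _ _).mpr h₂))
      ((Submodule.span_singleton_le_iff_mem _ _).mpr h₁)
    rintro _ ⟨q, rfl⟩
    exact hy.dotProduct_boundary q
  have hWZ : W' ≤ LinearMap.ker G.bdry := by
    refine sup_le (sup_le ?_ ((Submodule.span_singleton_le_iff_mem _ _).mpr hc₂.bdry_eq_zero))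
      ((Submodule.span_singleton_le_iff_mem _ _).mpr hc₁.bdry_eq_zero)
    rintro _ ⟨q, rfl⟩
    exact S.bdry_boundary q
  -- Two proper extensions reach the dimension of the cycle space.
  have hlt : finrank (ZMod 2) B < finrank (ZMod 2) W :=
    Submodule.finrank_lt_finrank_of_lt <| left_lt_sup.mpr fun h =>
      hz₂B (h (Submodule.mem_span_singleton_self z₂))
  have hlt' : finrank (ZMod 2) W < finrank (ZMod 2) W' :=
    Submodule.finrank_lt_finrank_of_lt <| left_lt_sup.mpr fun h =>
      hz₁W (h (Submodule.mem_span_singleton_self z₁))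
  have hdim := S.finrank_ker_bdry_le hG hS.2
  rw [← hB] at hdim
  have heq : W' = LinearMap.ker G.bdry := Submodule.eq_of_le_of_finrank_le hWZ (by omega)
  refine hy.homologicallyTrivial fun u hu => ?_
  rw [dotProduct_comm]
  have hu' : u ∈ W' := by rw [heq]; exact hu
  exact hle hu'
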